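/- A Pisot number is a real algebraic integer greater than $1$ all of whose conjugates (over $\mathbb{Q}$, in $\mathbb{C}$) other than itself have absolute value less than $1$. A Salem number is a real algebraic integer greater than $1$ all of whose conjugates other than itself have absolute value at most $1$, with at least one conjugate of absolute value exactly $1$. For real $y>0$ put $$\xi(y;X):=1+\sum_{m=1}^{\infty}X^{\lfloor \varphi(y;m)\rfloor},\qquad \varphi(y;R):=\exp\bigl((\log R)^{1+y}\bigr)=R^{(\log R)^y}\quad(R\ge 1).$$ Let $y_1$ and $y_2$ be distinct positive real numbers. Then for any Pisot or Salem number $\beta$ the two values $\xi(y_1;\beta^{-1})$ and $\xi(y_2;\beta^{-1})$ are algebraically independent over $\mathbb{Q}$. -/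

import Mathlib

/-- A Pisot number: a real algebraic integer greater than `1`, all of whose conjugates over `ℚ`
in `ℂ` other than itself have absolute value less than `1`. -/
def IsPisotNumber (β : ℝ) : Prop :=
  IsIntegral ℤ β ∧ 1 < β ∧
    ∀ z : ℂ, IsConjRoot ℚ (β : ℂ) z → z ≠ (β : ℂ) → ‖z‖ < 1

/-- A Salem number: a real algebraic integer greater than `1`, all of whose conjugates over `ℚ`
in `ℂ` other than itself have absolute value at most `1`, at least one of them having absolute
value exactly `1`. -/
def IsSalemNumber (β : ℝ) : Prop :=
  IsIntegral ℤ β ∧ 1 < β ∧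
    (∀ z : ℂ, IsConjRoot ℚ (β : ℂ) z → z ≠ (β : ℂ) → ‖z‖ ≤ 1) ∧
    ∃ z : ℂ, IsConjRoot ℚ (β : ℂ) z ∧ ‖z‖ = 1

/-- `φ(y; R) = exp ((log R) ^ (1 + y))`, used for `y > 0` and `R ≥ 1`. -/
noncomputable def phiFun (y R : ℝ) : ℝ :=
  Real.exp (Real.log R ^ (1 + y))

/-- The value at `x` of the power series `ξ(y; X) = 1 + ∑_{m ≥ 1} X ^ ⌊φ(y; m)⌋`
(the summation index is shifted by one). -/
noncomputable def xiValue (y x : ℝ) : ℝ :=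
  1 + ∑' m : ℕ, x ^ ⌊phiFun y ((m : ℝ) + 1)⌋₊

/-! Let `y₁ < y₂` and suppose the two values satisfy a polynomial relation over ℤ. After
multiplication by both variables, its lexicographically largest monomial is X^(a+1) Y^(b+1).
Substituting the series F₁, F₂ of ξ(y₁; X), ξ(y₂; X) gives an integral series G of polynomial growth
vanishing at β⁻¹.

Arithmetic (`PolyBounded.exists_gap_obstruction`): if the coefficients of G vanish on a window (R,
R+W], then β^R times the partial sum up to R is a polynomial in β over ℤ of size at most
poly(N)·β^(-W). All other conjugates of β lie in the closed unit disc, so those of this number are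
at most poly(N). Its norm is an integer, so it vanishes once W exceeds a multiple of log N. But
nonnegative coefficients over a long stretch beyond R, one of them nonzero, force the partial sum to
be negative.

Combinatorics (`exists_isolated_exponent`): such a place exists for arbitrarily large N. Take N
close to φ(y₁; Q^(k+2)). Up to N, F₁ has at most Q^(k+2) exponents and F₂ at most Q, because φ(y₂;
·) grows faster. Hence F₁^a F₂^D leaves gaps much longer than φ(y₁; Q^(k+2)) / Q^(k(a+1)), whereas
greedy sums of a+1 exponents of F₁ are at least that dense (`exists_coeff_pow_near`). Inside such a
gap, a second pigeonhole isolates an exponent of the leading product from all lower terms, and a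
third finds a window of length W = Q free of every term. Since log N is of order (log Q)^(1+y₁), far
below Q, the obstruction applies. -/

/-! ### Evaluation of integral power series of polynomial growth -/

open PowerSeries in
/-- A power series with integer coefficients of at most polynomial growth. -/
def PolyBounded (F : PowerSeries ℤ) : Prop :=
  ∃ (C : ℝ) (k : ℕ), 0 ≤ C ∧ ∀ n, |((coeff n F : ℤ) : ℝ)| ≤ C * ((n : ℝ) + 1) ^ k

/-- The value at `x` of an integral power series. -/
noncomputable def seriesValue (x : ℝ) (F : PowerSeries ℤ) : ℝ :=
  ∑' n, ((PowerSeries.coeff n F : ℤ) : ℝ) * x ^ n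

lemma summable_succ_pow_mul_pow (k : ℕ) {x : ℝ} (hx0 : 0 < x) (hx1 : x < 1) :
    Summable fun n : ℕ => ((n : ℝ) + 1) ^ k * x ^ n := by
  have h := (summable_pow_mul_geometric_of_norm_lt_one (R := ℝ) k (r := x)
    (by rwa [Real.norm_eq_abs, abs_of_pos hx0]))
  have h2 := ((summable_nat_add_iff 1).2 h).mul_right x⁻¹
  refine h2.congr fun n => ?_
  push_cast
  field_simp
  ring

namespace PolyBounded

lemma C (a : ℤ) : PolyBounded (PowerSeries.C a) := by
  refine ⟨|(a : ℝ)|, 0, abs_nonneg _, fun n => ?_⟩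
  rw [PowerSeries.coeff_C]
  split_ifs <;> simp

lemma add {F G : PowerSeries ℤ} (hF : PolyBounded F) (hG : PolyBounded G) :
    PolyBounded (F + G) := by
  obtain ⟨C₁, k₁, hC₁, h₁⟩ := hF
  obtain ⟨C₂, k₂, hC₂, h₂⟩ := hG
  refine ⟨C₁ + C₂, k₁ + k₂, by positivity, fun n => ?_⟩
  have hn : (1 : ℝ) ≤ (n : ℝ) + 1 := by linarith [(Nat.cast_nonneg n : (0 : ℝ) ≤ n)]
  rw [map_add, Int.cast_add, add_mul]
  refine (abs_add_le _ _).trans (add_le_add ((h₁ n).trans ?_) ((h₂ n).trans ?_))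
  · exact mul_le_mul_of_nonneg_left (pow_le_pow_right₀ hn (by omega)) hC₁
  · exact mul_le_mul_of_nonneg_left (pow_le_pow_right₀ hn (by omega)) hC₂

lemma mul {F G : PowerSeries ℤ} (hF : PolyBounded F) (hG : PolyBounded G) :
    PolyBounded (F * G) := by
  obtain ⟨C₁, k₁, hC₁, h₁⟩ := hF
  obtain ⟨C₂, k₂, hC₂, h₂⟩ := hG
  refine ⟨C₁ * C₂, k₁ + k₂ + 1, by positivity, fun n => ?_⟩
  rw [PowerSeries.coeff_mul, Int.cast_sum]
  refine (Finset.abs_sum_le_sum_abs _ _).trans ?_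
  have : ∀ p ∈ Finset.HasAntidiagonal.antidiagonal n,
      |((PowerSeries.coeff p.1 F * PowerSeries.coeff p.2 G : ℤ) : ℝ)| ≤
        C₁ * C₂ * ((n : ℝ) + 1) ^ (k₁ + k₂) := by
    intro p hp
    rw [Finset.HasAntidiagonal.mem_antidiagonal] at hp
    have hp' : (p.1 : ℝ) + p.2 = n := by exact_mod_cast hp
    have e1 : (0 : ℝ) ≤ p.1 := Nat.cast_nonneg _
    have e2 : (0 : ℝ) ≤ p.2 := Nat.cast_nonneg _
    rw [Int.cast_mul, abs_mul, pow_add, mul_mul_mul_comm]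
    gcongr
    · refine (h₁ _).trans ?_
      gcongr
      linarith
    · refine (h₂ _).trans ?_
      gcongr
      linarith
  refine (Finset.sum_le_card_nsmul _ _ _ this).trans ?_
  rw [Finset.Nat.card_antidiagonal, nsmul_eq_mul]
  push_cast
  rw [pow_succ ((n : ℝ) + 1) (k₁ + k₂)]
  exact le_of_eq (by ring)

lemma pow {F : PowerSeries ℤ} (hF : PolyBounded F) (m : ℕ) : PolyBounded (F ^ m) := by
  induction m with
  | zero => simpa using C 1
  | succ m ih => rw [pow_succ]; exact ih.mul hF

lemma sum {ι : Type*} (s : Finset ι) {F : ι → PowerSeries ℤ} (h : ∀ i ∈ s, PolyBounded (F i)) :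
    PolyBounded (∑ i ∈ s, F i) := by
  classical
  induction s using Finset.induction_on with
  | empty => simpa using C 0
  | insert a s ha ih =>
    rw [Finset.sum_insert ha]
    exact (h a (by simp)).add (ih fun i hi => h i (by simp [hi]))

variable {x : ℝ} {F G : PowerSeries ℤ}

lemma summable_norm (hF : PolyBounded F) (hx0 : 0 < x) (hx1 : x < 1) :
    Summable fun n => ‖((PowerSeries.coeff n F : ℤ) : ℝ) * x ^ n‖ := by
  obtain ⟨C, k, hC, h⟩ := hF
  refine Summable.of_nonneg_of_le (fun _ => norm_nonneg _) (fun n => ?_)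
    ((summable_succ_pow_mul_pow k hx0 hx1).mul_left C)
  rw [norm_mul, Real.norm_eq_abs, Real.norm_of_nonneg (by positivity), ← mul_assoc]
  exact mul_le_mul_of_nonneg_right (h n) (by positivity)

lemma seriesValue_add (hF : PolyBounded F) (hG : PolyBounded G) (hx0 : 0 < x) (hx1 : x < 1) :
    seriesValue x (F + G) = seriesValue x F + seriesValue x G := by
  unfold seriesValue
  rw [← ((hF.summable_norm hx0 hx1).of_norm).tsum_add ((hG.summable_norm hx0 hx1).of_norm)]
  congr 1; ext n
  push_cast [map_add]; ring

lemma seriesValue_mul (hF : PolyBounded F) (hG : PolyBounded G) (hx0 : 0 < x) (hx1 : x < 1) :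
    seriesValue x (F * G) = seriesValue x F * seriesValue x G := by
  unfold seriesValue
  rw [tsum_mul_tsum_eq_tsum_sum_antidiagonal_of_summable_norm
    (hF.summable_norm hx0 hx1) (hG.summable_norm hx0 hx1)]
  congr 1; ext n
  rw [PowerSeries.coeff_mul, Int.cast_sum, Finset.sum_mul]
  refine Finset.sum_congr rfl fun p hp => ?_
  rw [Finset.HasAntidiagonal.mem_antidiagonal] at hp
  rw [← hp, pow_add]
  push_cast; ring

end PolyBounded

lemma seriesValue_C (x : ℝ) (a : ℤ) : seriesValue x (PowerSeries.C a) = a := by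
  unfold seriesValue
  rw [tsum_eq_single 0]
  · simp
  · intro n hn
    rw [PowerSeries.coeff_C, if_neg hn]; simp

namespace PolyBounded

variable {x : ℝ} {F G : PowerSeries ℤ}

lemma seriesValue_pow (hF : PolyBounded F) (hx0 : 0 < x) (hx1 : x < 1) (m : ℕ) :
    seriesValue x (F ^ m) = seriesValue x F ^ m := by
  induction m with
  | zero => simpa using seriesValue_C x 1
  | succ m ih => rw [pow_succ, pow_succ, (hF.pow m).seriesValue_mul hF hx0 hx1, ih]

lemma seriesValue_sum {ι : Type*} (s : Finset ι) {F : ι → PowerSeries ℤ}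
    (h : ∀ i ∈ s, PolyBounded (F i)) (hx0 : 0 < x) (hx1 : x < 1) :
    seriesValue x (∑ i ∈ s, F i) = ∑ i ∈ s, seriesValue x (F i) := by
  classical
  induction s using Finset.induction_on with
  | empty => simpa using seriesValue_C x 0
  | insert a s ha ih =>
    rw [Finset.sum_insert ha, Finset.sum_insert ha,
      (h a (by simp)).seriesValue_add (sum s fun i hi => h i (by simp [hi])) hx0 hx1,
      ih fun i hi => h i (by simp [hi])]

end PolyBounded

/-! ### Supports of products and pigeonhole for gaps -/

/-- Integral power series with nonnegative coefficients. -/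
def CoeffNonneg (F : PowerSeries ℤ) : Prop := ∀ n, 0 ≤ PowerSeries.coeff n F

/-- The exponents at most `N` occurring in `F`. -/
noncomputable def suppUpTo (F : PowerSeries ℤ) (N : ℕ) : Finset ℕ :=
  (Finset.range (N + 1)).filter fun n => PowerSeries.coeff n F ≠ 0

lemma mem_suppUpTo {F : PowerSeries ℤ} {N n : ℕ} :
    n ∈ suppUpTo F N ↔ n ≤ N ∧ PowerSeries.coeff n F ≠ 0 := by
  simp [suppUpTo]

lemma card_suppUpTo_mul_le (F G : PowerSeries ℤ) (N : ℕ) :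
    (suppUpTo (F * G) N).card ≤ (suppUpTo F N).card * (suppUpTo G N).card := by
  classical
  rw [← Finset.card_product]
  refine le_trans (Finset.card_le_card ?_)
    (Finset.card_image_le (f := fun p : ℕ × ℕ => p.1 + p.2))
  intro n hn
  rw [mem_suppUpTo, PowerSeries.coeff_mul] at hn
  obtain ⟨p, hp, hne⟩ := Finset.exists_ne_zero_of_sum_ne_zero hn.2
  rw [Finset.HasAntidiagonal.mem_antidiagonal] at hp
  rw [Finset.mem_image]
  refine ⟨p, ?_, hp⟩
  rw [Finset.mem_product, mem_suppUpTo, mem_suppUpTo]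
  exact ⟨⟨by omega, left_ne_zero_of_mul hne⟩, ⟨by omega, right_ne_zero_of_mul hne⟩⟩

lemma card_suppUpTo_pow_le (F : PowerSeries ℤ) (N m : ℕ) :
    (suppUpTo (F ^ m) N).card ≤ (suppUpTo F N).card ^ m := by
  induction m with
  | zero =>
    rw [pow_zero, pow_zero, Finset.card_le_one]
    intro a ha b hb
    rw [mem_suppUpTo, PowerSeries.coeff_one] at ha hb
    simp only [ne_eq, ite_eq_right_iff, one_ne_zero, imp_false, not_not] at ha hb
    omega
  | succ m ih =>
    rw [pow_succ, pow_succ]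
    exact (card_suppUpTo_mul_le _ _ _).trans (Nat.mul_le_mul_right _ ih)

namespace CoeffNonneg

variable {F G : PowerSeries ℤ}

lemma mul (hF : CoeffNonneg F) (hG : CoeffNonneg G) : CoeffNonneg (F * G) := by
  intro n
  rw [PowerSeries.coeff_mul]
  exact Finset.sum_nonneg fun p _ => mul_nonneg (hF _) (hG _)

lemma pow (hF : CoeffNonneg F) (m : ℕ) : CoeffNonneg (F ^ m) := by
  induction m with
  | zero =>
    intro n
    rw [pow_zero, PowerSeries.coeff_one]
    split_ifs <;> simp
  | succ m ih => rw [pow_succ]; exact ih.mul hF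

lemma coeff_add_mul_ne_zero (hF : CoeffNonneg F) (hG : CoeffNonneg G) {m n : ℕ}
    (hm : PowerSeries.coeff m F ≠ 0) (hn : PowerSeries.coeff n G ≠ 0) :
    PowerSeries.coeff (m + n) (F * G) ≠ 0 := by
  rw [PowerSeries.coeff_mul]
  refine ne_of_gt (Finset.sum_pos' (fun p _ => mul_nonneg (hF _) (hG _)) ⟨(m, n), by simp, ?_⟩)
  exact mul_pos (lt_of_le_of_ne (hF _) hm.symm) (lt_of_le_of_ne (hG _) hn.symm)

/-- Exponent 0 can always be added, so supports increase with the powers. This lets one product with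
maximal powers stand for a whole family of monomials. -/
lemma coeff_pow_mul_pow_ne_zero (hF : CoeffNonneg F) (hG : CoeffNonneg G)
    (hF0 : PowerSeries.coeff 0 F ≠ 0) (hG0 : PowerSeries.coeff 0 G ≠ 0) {a b a' b' n : ℕ}
    (ha : a ≤ a') (hb : b ≤ b') (h : PowerSeries.coeff n (F ^ a * G ^ b) ≠ 0) :
    PowerSeries.coeff n (F ^ a' * G ^ b') ≠ 0 := by
  obtain ⟨u, rfl⟩ := Nat.exists_eq_add_of_le ha
  obtain ⟨v, rfl⟩ := Nat.exists_eq_add_of_le hb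
  have e : F ^ (a + u) * G ^ (b + v) = (F ^ a * G ^ b) * (F ^ u * G ^ v) := by ring
  rw [e]
  refine coeff_add_mul_ne_zero (n := 0) ((hF.pow a).mul (hG.pow b))
    ((hF.pow u).mul (hG.pow v)) h ?_
  rw [PowerSeries.coeff_zero_eq_constantCoeff_apply] at *
  simp [hF0, hG0]

end CoeffNonneg

/-- Among `k` consecutive blocks of length `l`, one avoids a given set with fewer than `k`
elements. -/
lemma exists_block_avoiding (W : Finset ℕ) {k l : ℕ} (hW : W.card < k) (a : ℕ) :
    ∃ b, a ≤ b ∧ b + l ≤ a + l * k ∧ ∀ n ∈ W, b ≤ n → ¬ n < b + l := by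
  by_contra! H
  have : ∀ j ∈ Finset.range k, ∃ n ∈ W, a + l * j ≤ n ∧ n < a + l * j + l := by
    intro j hj
    rw [Finset.mem_range] at hj
    refine H (a + l * j) (by omega) ?_
    have : l * (j + 1) ≤ l * k := Nat.mul_le_mul_left _ hj
    rw [Nat.mul_succ] at this
    omega
  choose! f hf using this
  have hinj : Set.InjOn f (Finset.range k : Set ℕ) := by
    intro i hi j hj hij
    have h1 := (hf i (by simpa using hi)).2
    have h2 := (hf j (by simpa using hj)).2
    rw [hij] at h1
    rcases lt_trichotomy i j with h | h | h
    · have : l * (i + 1) ≤ l * j := Nat.mul_le_mul_left _ h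
      rw [Nat.mul_succ] at this
      omega
    · exact h
    · have : l * (j + 1) ≤ l * i := Nat.mul_le_mul_left _ h
      rw [Nat.mul_succ] at this
      omega
  have := Finset.card_le_card_of_injOn f (fun i hi => (hf i (by simpa using hi)).1) hinj
  rw [Finset.card_range] at this
  omega

/-! ### Liouville's inequality and the gap obstruction -/

open Polynomial in
/-- Liouville's inequality for an algebraic integer whose other conjugates lie in the closed unit
disc. -/
lemma exists_liouville_exponent {β : ℝ} (hint : IsIntegral ℤ β)
    (hconj : ∀ z : ℂ, IsConjRoot ℚ (β : ℂ) z → z ≠ (β : ℂ) → ‖z‖ ≤ 1) :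
    ∃ d : ℕ, ∀ (Q : ℤ[X]) (H : ℝ), 1 ≤ H → aeval β Q ≠ 0 →
      (∀ z : ℂ, ‖z‖ ≤ 1 → ‖aeval z Q‖ ≤ H) → 1 ≤ |aeval β Q| * H ^ d := by
  classical
  have hintC : IsIntegral ℤ (β : ℂ) := hint.map (algebraMap ℝ ℂ).toIntAlgHom
  have hintQ : IsIntegral ℚ (β : ℂ) := hintC.tower_top
  let K := IntermediateField.adjoin ℚ {(β : ℂ)}
  have : FiniteDimensional ℚ K := IntermediateField.adjoin.finiteDimensional hintQ
  let g : K := IntermediateField.AdjoinSimple.gen ℚ (β : ℂ)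
  have hg : algebraMap K ℂ g = β := IntermediateField.AdjoinSimple.algebraMap_gen ℚ (β : ℂ)
  have hgint : IsIntegral ℤ g := by
    rw [← isIntegral_algebraMap_iff (algebraMap K ℂ).injective (B := ℂ), hg]
    exact hintC
  -- The exponent counts the embeddings of ℚ(β) other than the inclusion.
  refine ⟨(Finset.univ.erase (IsScalarTower.toAlgHom ℚ K ℂ)).card, fun Q H hH hQ hbd => ?_⟩
  have hreal : ‖aeval (β : ℂ) Q‖ = |aeval β Q| := by
    have : aeval (β : ℂ) Q = ((aeval β Q : ℝ) : ℂ) := by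
      rw [← Complex.coe_algebraMap, aeval_algebraMap_apply]
    rw [this, Complex.norm_real, Real.norm_eq_abs]
  -- Once the value is known to be below 1, hence below H, a factor of the norm with `σ g = β` needs
  -- no separate argument.
  rcases le_or_gt 1 |aeval β Q| with h1 | h1
  · exact one_le_mul_of_one_le_of_one_le h1 (one_le_pow₀ hH)
  have hval : ∀ σ : K →ₐ[ℚ] ℂ, σ (aeval g Q) = aeval (σ g) Q := fun σ =>
    (aeval_algHom_apply (σ.toRingHom.toIntAlgHom) g Q).symm
  have hσ0 : (IsScalarTower.toAlgHom ℚ K ℂ) (aeval g Q) = aeval (β : ℂ) Q := by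
    rw [hval]
    exact congrArg (fun z : ℂ => aeval z Q) hg
  have hx0 : aeval g Q ≠ 0 := by
    intro h0
    rw [h0, map_zero] at hσ0
    rw [← hσ0, norm_zero] at hreal
    exact hQ (abs_eq_zero.1 hreal.symm)
  have hxint : IsIntegral ℤ (aeval g Q) := by
    exact (Subalgebra.aeval_coe (integralClosure ℤ K) ⟨g, hgint⟩ Q) ▸
      (aeval (⟨g, hgint⟩ : integralClosure ℤ K) Q).2
  obtain ⟨n, hn⟩ := (IsIntegrallyClosed.isIntegral_iff (R := ℤ) (K := ℚ)).1
    (Algebra.isIntegral_norm ℚ hxint)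
  have hn0 : n ≠ 0 := by
    rintro rfl
    rw [map_zero] at hn
    exact hx0 (Algebra.norm_eq_zero_iff.1 hn.symm)
  have hprod := Algebra.norm_eq_prod_embeddings ℚ ℂ (aeval g Q)
  have hge : (1 : ℝ) ≤ ‖algebraMap ℚ ℂ (Algebra.norm ℚ (aeval g Q))‖ := by
    rw [← hn]
    simp only [algebraMap_int_eq, eq_intCast, map_intCast, Complex.norm_intCast]
    exact_mod_cast Int.one_le_abs hn0
  rw [hprod, norm_prod, ← Finset.mul_prod_erase _ _
    (Finset.mem_univ (IsScalarTower.toAlgHom ℚ K ℂ)), hσ0, hreal] at hge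
  refine hge.trans (mul_le_mul_of_nonneg_left ?_ (abs_nonneg _))
  refine (Finset.prod_le_prod (fun _ _ => norm_nonneg _) (g := fun _ => H) fun σ _ => ?_).trans
    (by rw [Finset.prod_const])
  rw [hval]
  by_cases hσ : σ g = β
  · rw [hσ, hreal]
    exact h1.le.trans hH
  · refine hbd _ (hconj _ ?_ hσ)
    rw [IsConjRoot, minpoly.algHom_eq σ σ.injective, ← hg]
    exact minpoly.algHom_eq (IsScalarTower.toAlgHom ℚ K ℂ) (algebraMap K ℂ).injective g

/-- A tail of a power series with polynomially bounded coefficients. -/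
lemma abs_tsum_tail_le {c : ℕ → ℤ} {C : ℝ} {k : ℕ} (hC : 0 ≤ C)
    (hc : ∀ n, |(c n : ℝ)| ≤ C * ((n : ℝ) + 1) ^ k) {x : ℝ} (hx0 : 0 < x) (hx1 : x < 1) (N : ℕ) :
    |∑' j : ℕ, (c (j + N) : ℝ) * x ^ (j + N)| ≤
      x ^ N * ((C * ∑' j : ℕ, ((j : ℝ) + 1) ^ k * x ^ j) * ((N : ℝ) + 1) ^ k) := by
  have hs := summable_succ_pow_mul_pow k hx0 hx1
  have hb : ∀ j : ℕ, ‖(c (j + N) : ℝ) * x ^ (j + N)‖ ≤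
      (x ^ N * (C * ((N : ℝ) + 1) ^ k)) * (((j : ℝ) + 1) ^ k * x ^ j) := by
    intro j
    have hj : (0 : ℝ) ≤ j := Nat.cast_nonneg _
    have hN : (0 : ℝ) ≤ N := Nat.cast_nonneg _
    have h1 : (((j + N : ℕ) : ℝ) + 1) ^ k ≤ ((N : ℝ) + 1) ^ k * ((j : ℝ) + 1) ^ k := by
      rw [← mul_pow]
      gcongr
      push_cast
      nlinarith
    rw [norm_mul, Real.norm_eq_abs, Real.norm_of_nonneg (by positivity), pow_add]
    calc |(c (j + N) : ℝ)| * (x ^ j * x ^ N)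
        ≤ (C * (((N : ℝ) + 1) ^ k * ((j : ℝ) + 1) ^ k)) * (x ^ j * x ^ N) := by
          gcongr
          exact (hc _).trans (mul_le_mul_of_nonneg_left h1 hC)
      _ = _ := by ring
  rw [← Real.norm_eq_abs]
  refine (tsum_of_norm_bounded (hs.mul_left _).hasSum hb).trans ?_
  rw [tsum_mul_left]
  exact le_of_eq (by ring)

/-- If an integral power series with polynomially bounded coefficients vanishes at `β⁻¹`, then
a window of vanishing coefficients and, further on, a run of nonnegative coefficients cannot both
be long on a logarithmic scale. -/
lemma PolyBounded.exists_gap_obstruction {β : ℝ} (hβ1 : 1 < β) (hint : IsIntegral ℤ β)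
    (hconj : ∀ z : ℂ, IsConjRoot ℚ (β : ℂ) z → z ≠ (β : ℂ) → ‖z‖ ≤ 1)
    {G : PowerSeries ℤ} (hG : PolyBounded G) (h0 : seriesValue β⁻¹ G = 0) :
    ∃ (C : ℝ) (e : ℕ), ∀ N R t q W : ℕ, R < t → R + W + 1 ≤ N → q ≤ N → t + W ≤ q →
      C * ((N : ℝ) + 2) ^ e < β ^ W →
      (∀ n, R < n → n ≤ R + W → PowerSeries.coeff n G = 0) →
      (∀ n, R < n → n < q → 0 ≤ PowerSeries.coeff n G) →
      PowerSeries.coeff t G ≠ 0 → False := by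
  obtain ⟨d, hd⟩ := exists_liouville_exponent hint hconj
  have hsum := (hG.summable_norm (x := β⁻¹) (by positivity) (inv_lt_one_of_one_lt₀ hβ1)).of_norm
  obtain ⟨C, k, hC, hc⟩ := hG
  set c : ℕ → ℤ := fun n => PowerSeries.coeff n G with hcdef
  set x : ℝ := β⁻¹ with hx
  have hx0 : 0 < x := by positivity
  have hx1 : x < 1 := inv_lt_one_of_one_lt₀ hβ1
  set S : ℝ := C * ∑' j : ℕ, ((j : ℝ) + 1) ^ k * x ^ j with hS
  have hS0 : 0 ≤ S := mul_nonneg hC (tsum_nonneg fun j => by positivity)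
  have htail := abs_tsum_tail_le (c := c) hC hc hx0 hx1
  rw [← hS] at htail
  refine ⟨(S + 1) * (C + 1) ^ d, k + (k + 1) * d, ?_⟩
  intro N R t q W hRt hRN hqN htq hW hzero hnn ht
  set Z : ℝ := (N : ℝ) + 2 with hZ
  have hZ1 : 1 ≤ Z := by rw [hZ]; linarith [(Nat.cast_nonneg N : (0 : ℝ) ≤ N)]
  have hxβ : ∀ m : ℕ, x ^ m * β ^ m = 1 := fun m => by
    rw [← mul_pow, hx, inv_mul_cancel₀ (by positivity), one_pow]
  have hpow : ∀ m : ℕ, m ≤ N → ((m : ℝ) + 1) ^ k ≤ Z ^ k := fun m hm => by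
    have : (m : ℝ) ≤ N := by exact_mod_cast hm
    gcongr
    rw [hZ]; linarith
  have hSW : S * Z ^ k < β ^ W := by
    refine lt_of_le_of_lt ?_ hW
    rw [pow_add]
    have : 1 ≤ (C + 1) ^ d := one_le_pow₀ (by linarith)
    have h2 : 1 ≤ Z ^ ((k + 1) * d) := one_le_pow₀ hZ1
    calc S * Z ^ k = (S * 1) * (Z ^ k * 1) := by ring
      _ ≤ ((S + 1) * (C + 1) ^ d) * (Z ^ k * Z ^ ((k + 1) * d)) := by
          gcongr
          linarith
  -- the initial segment is the negative of the tail
  have hsplit : ∀ m : ℕ, ∑ n ∈ Finset.range m, (c n : ℝ) * x ^ n =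
      -∑' j : ℕ, (c (j + m) : ℝ) * x ^ (j + m) := fun m => by
    have := hsum.sum_add_tsum_nat_add m
    rw [show (∑' n, (c n : ℝ) * x ^ n) = 0 from h0] at this
    linarith
  set E : ℝ := ∑ n ∈ Finset.range (R + 1), (c n : ℝ) * x ^ n with hE
  -- The partial sum up to q is minus a tail of size below x^t, because q ≥ t + W; the terms
  -- strictly between R and q contribute at least x^t.
  have hEneg : E < 0 := by
    have h1 : E + ∑ n ∈ Finset.Ico (R + 1) q, (c n : ℝ) * x ^ n =
        ∑ n ∈ Finset.range q, (c n : ℝ) * x ^ n :=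
      Finset.sum_range_add_sum_Ico _ (by omega)
    have h2 : x ^ t ≤ ∑ n ∈ Finset.Ico (R + 1) q, (c n : ℝ) * x ^ n := by
      have hpos : ∀ n ∈ Finset.Ico (R + 1) q, 0 ≤ (c n : ℝ) * x ^ n := fun n hn => by
        rw [Finset.mem_Ico] at hn
        exact mul_nonneg (by exact_mod_cast hnn n (by omega) hn.2) (by positivity)
      have hWpos : 0 < W := by
        rcases Nat.eq_zero_or_pos W with h | h
        · rw [h, pow_zero] at hW
          exfalso
          have a1 : 1 ≤ Z ^ (k + (k + 1) * d) := one_le_pow₀ hZ1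
          have a2 : 1 ≤ (C + 1) ^ d := one_le_pow₀ (by linarith)
          have a3 : 1 ≤ (S + 1) * (C + 1) ^ d := one_le_mul_of_one_le_of_one_le (by linarith) a2
          have a4 := one_le_mul_of_one_le_of_one_le a3 a1
          linarith
        · exact h
      have hmem : t ∈ Finset.Ico (R + 1) q := by rw [Finset.mem_Ico]; omega
      refine le_trans ?_ (Finset.single_le_sum hpos hmem)
      have : (1 : ℝ) ≤ c t := by
        have h3 : 0 ≤ c t := hnn t hRt (by omega)
        have h4 : 1 ≤ c t := by
          have : c t ≠ 0 := ht
          omega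
        exact_mod_cast h4
      nlinarith [pow_pos hx0 t]
    have h3 : |∑' j : ℕ, (c (j + q) : ℝ) * x ^ (j + q)| < x ^ t := by
      refine (htail q).trans_lt ?_
      have h5 : x ^ q ≤ x ^ (t + W) := pow_le_pow_of_le_one hx0.le hx1.le htq
      have h6 : S * ((q : ℝ) + 1) ^ k < β ^ W :=
        (mul_le_mul_of_nonneg_left (hpow q hqN) hS0).trans_lt hSW
      calc x ^ q * (S * ((q : ℝ) + 1) ^ k) ≤ x ^ (t + W) * (S * ((q : ℝ) + 1) ^ k) := by
            gcongr
        _ < x ^ (t + W) * β ^ W := by gcongr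
        _ = x ^ t := by rw [pow_add, mul_assoc, hxβ, mul_one]
    rw [hsplit q] at h1
    have := neg_abs_le (∑' j : ℕ, (c (j + q) : ℝ) * x ^ (j + q))
    linarith
  have hEsmall : |E| ≤ x ^ (R + W + 1) * (S * Z ^ k) := by
    have h1 : E = ∑ n ∈ Finset.range (R + W + 1), (c n : ℝ) * x ^ n := by
      rw [← Finset.sum_range_add_sum_Ico _ (show R + 1 ≤ R + W + 1 by omega),
        Finset.sum_eq_zero (s := Finset.Ico _ _), add_zero]
      intro n hn
      rw [Finset.mem_Ico] at hn
      rw [show c n = 0 from hzero n (by omega) (by omega)]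
      simp
    rw [h1, hsplit, abs_neg]
    refine (htail _).trans ?_
    exact mul_le_mul_of_nonneg_left (mul_le_mul_of_nonneg_left (hpow _ hRN) hS0) (by positivity)
  -- the associated polynomial
  set Q : Polynomial ℤ := ∑ n ∈ Finset.range (R + 1),
    Polynomial.C (c n) * Polynomial.X ^ (R - n) with hQ
  have hQβ : Polynomial.aeval β Q = β ^ R * E := by
    rw [hQ, map_sum, hE, Finset.mul_sum]
    refine Finset.sum_congr rfl fun n hn => ?_
    rw [Finset.mem_range] at hn
    have : β ^ R = β ^ (R - n) * β ^ n := by rw [← pow_add]; congr 1; omega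
    simp only [map_mul, map_pow, Polynomial.aeval_X, eq_intCast, map_intCast]
    rw [this]
    linear_combination (-(c n : ℝ) * β ^ (R - n)) * hxβ n
  -- In the closed unit disc Q has R + 1 ≤ Z terms, each at most C·Z^k.
  have hH1 : 1 ≤ (C + 1) * Z ^ (k + 1) :=
    one_le_mul_of_one_le_of_one_le (by linarith) (one_le_pow₀ hZ1)
  have hL := hd Q ((C + 1) * Z ^ (k + 1)) hH1
    (by rw [hQβ]; exact mul_ne_zero (by positivity) hEneg.ne) ?_
  · rw [hQβ, abs_mul, abs_of_pos (by positivity : 0 < β ^ R)] at hL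
    have h7 : β ^ R * |E| < x ^ W * (S * Z ^ k + 1) := by
      calc β ^ R * |E| ≤ β ^ R * (x ^ (R + W + 1) * (S * Z ^ k)) := by gcongr
        _ = (x ^ R * β ^ R) * (x ^ W * x * (S * Z ^ k)) := by ring
        _ = x ^ W * (x * (S * Z ^ k)) := by rw [hxβ]; ring
        _ < x ^ W * (S * Z ^ k + 1) := by
          gcongr
          have : 0 ≤ S * Z ^ k := by positivity
          nlinarith
    have h8 : (1 : ℝ) < 1 := by
      calc (1 : ℝ) ≤ β ^ R * |E| * ((C + 1) * Z ^ (k + 1)) ^ d := hL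
        _ < x ^ W * (S * Z ^ k + 1) * ((C + 1) * Z ^ (k + 1)) ^ d := by gcongr
        _ ≤ x ^ W * ((S + 1) * Z ^ k) * ((C + 1) * Z ^ (k + 1)) ^ d := by
          gcongr
          nlinarith [one_le_pow₀ hZ1 (n := k)]
        _ = x ^ W * ((S + 1) * (C + 1) ^ d * Z ^ (k + (k + 1) * d)) := by
          rw [mul_pow, ← pow_mul, pow_add]; ring
        _ ≤ x ^ W * β ^ W := by gcongr
        _ = 1 := hxβ W
    exact lt_irrefl _ h8
  · intro z hz
    rw [hQ, map_sum]
    have : ∀ n ∈ Finset.range (R + 1),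
        ‖Polynomial.aeval z (Polynomial.C (c n) * Polynomial.X ^ (R - n))‖ ≤ C * Z ^ k := by
      intro n hn
      rw [Finset.mem_range] at hn
      simp only [map_mul, map_pow, Polynomial.aeval_X, eq_intCast, map_intCast, norm_mul, norm_pow, Complex.norm_intCast]
      calc |(c n : ℝ)| * ‖z‖ ^ (R - n) ≤ (C * Z ^ k) * 1 := by
            gcongr
            · exact (hc n).trans (mul_le_mul_of_nonneg_left (hpow n (by omega)) hC)
            · exact pow_le_one₀ (norm_nonneg _) hz
        _ = C * Z ^ k := mul_one _
    refine (norm_sum_le_of_le _ this).trans ?_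
    rw [Finset.sum_const, Finset.card_range, nsmul_eq_mul]
    have h9 : ((R + 1 : ℕ) : ℝ) ≤ Z := by
      have : ((R + 1 : ℕ) : ℝ) ≤ N := by exact_mod_cast (by omega : R + 1 ≤ N)
      rw [hZ]; linarith
    calc ((R + 1 : ℕ) : ℝ) * (C * Z ^ k) ≤ Z * ((C + 1) * Z ^ k) := by
          gcongr
          linarith
      _ = (C + 1) * Z ^ (k + 1) := by ring

/-! ### The exponents ⌊φ(y; m)⌋ and their generating series -/

section PhiFun

variable {y : ℝ}

lemma phiFun_lt_phiFun (hy : 0 < y) {a b : ℝ} (ha : 1 ≤ a) (hab : a < b) :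
    phiFun y a < phiFun y b := by
  unfold phiFun
  exact Real.exp_lt_exp.2 (Real.rpow_lt_rpow (Real.log_nonneg ha)
    (Real.log_lt_log (by linarith) hab) (by linarith))

lemma phiFun_le_phiFun (hy : 0 < y) {a b : ℝ} (ha : 1 ≤ a) (hab : a ≤ b) :
    phiFun y a ≤ phiFun y b := by
  rcases hab.eq_or_lt with rfl | h
  · exact le_rfl
  · exact (phiFun_lt_phiFun hy ha h).le

lemma one_le_phiFun {a : ℝ} (ha : 1 ≤ a) : 1 ≤ phiFun y a :=
  Real.one_le_exp (Real.rpow_nonneg (Real.log_nonneg ha) _)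

lemma le_phiFun (hy : 0 < y) {a : ℝ} (ha : 3 ≤ a) : a ≤ phiFun y a := by
  have h1 : 1 ≤ Real.log a := by
    rw [Real.le_log_iff_exp_le (by linarith)]
    exact (Real.exp_one_lt_d9.le.trans (by norm_num)).trans ha
  calc a = Real.exp (Real.log a) := (Real.exp_log (by linarith)).symm
    _ ≤ phiFun y a := Real.exp_le_exp.2 (Real.self_le_rpow_of_one_le h1 (by linarith))

/-- Makes each coefficient of `xiSeries` a finite count. The slack covers small arguments: φ(y; a) ≥
a is only available once log a ≥ 1. -/
lemma lt_add_three_of_floor_phiFun_eq (hy : 0 < y) {m n : ℕ}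
    (h : ⌊phiFun y ((m : ℝ) + 1)⌋₊ = n) : m < n + 3 := by
  rcases lt_or_ge m 2 with hm | hm
  · omega
  · have h1 : ((m + 1 : ℕ) : ℝ) ≤ phiFun y ((m : ℝ) + 1) := by
      push_cast
      have : (2 : ℝ) ≤ m := by exact_mod_cast hm
      exact le_phiFun hy (by linarith)
    have := Nat.le_floor h1
    omega

/-- The power series `1 + ∑_{m ≥ 1} X ^ ⌊φ(y; m)⌋`. -/
noncomputable def xiSeries (y : ℝ) : PowerSeries ℤ :=
  PowerSeries.mk fun n => (if n = 0 then 1 else 0) +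
    (((Finset.range (n + 3)).filter fun m : ℕ => ⌊phiFun y ((m : ℝ) + 1)⌋₊ = n).card : ℤ)

lemma xiSeries_coeffNonneg (y : ℝ) : CoeffNonneg (xiSeries y) := by
  intro n
  rw [xiSeries, PowerSeries.coeff_mk]
  split_ifs <;> positivity

lemma coeff_xiSeries_ne_zero_iff (hy : 0 < y) {n : ℕ} :
    PowerSeries.coeff n (xiSeries y) ≠ 0 ↔ n = 0 ∨ ∃ m : ℕ, 1 ≤ m ∧ ⌊phiFun y m⌋₊ = n := by
  rw [xiSeries, PowerSeries.coeff_mk]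
  constructor
  · intro h
    by_cases hn : n = 0
    · exact Or.inl hn
    · rw [if_neg hn, zero_add, Nat.cast_ne_zero, Finset.card_ne_zero] at h
      obtain ⟨m, hm⟩ := h
      rw [Finset.mem_filter] at hm
      exact Or.inr ⟨m + 1, by omega, by exact_mod_cast hm.2⟩
  · rintro (rfl | ⟨m, hm, hmn⟩)
    · rw [if_pos rfl]; positivity
    · obtain ⟨j, rfl⟩ := Nat.exists_eq_add_of_le' hm
      have hj : ⌊phiFun y ((j : ℝ) + 1)⌋₊ = n := by exact_mod_cast hmn
      have : 0 < ((Finset.range (n + 3)).filter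
          fun m : ℕ => ⌊phiFun y ((m : ℝ) + 1)⌋₊ = n).card :=
        Finset.card_pos.2 ⟨j, by
          rw [Finset.mem_filter, Finset.mem_range]
          exact ⟨lt_add_three_of_floor_phiFun_eq hy hj, hj⟩⟩
      split_ifs <;> positivity

lemma xiSeries_polyBounded (y : ℝ) : PolyBounded (xiSeries y) := by
  refine ⟨4, 1, by norm_num, fun n => ?_⟩
  rw [abs_of_nonneg (by exact_mod_cast xiSeries_coeffNonneg y n), xiSeries, PowerSeries.coeff_mk]
  have h := Finset.card_filter_le (Finset.range (n + 3))
    (fun m : ℕ => ⌊phiFun y ((m : ℝ) + 1)⌋₊ = n)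
  rw [Finset.card_range] at h
  have h' : ((((Finset.range (n + 3)).filter
      fun m : ℕ => ⌊phiFun y ((m : ℝ) + 1)⌋₊ = n).card : ℕ) : ℝ) ≤ n + 3 := by exact_mod_cast h
  have hn : (0 : ℝ) ≤ n := Nat.cast_nonneg _
  push_cast
  split_ifs <;> linarith

/-- Both sides sum x^n over pairs (n, m) for which the m-th exponent is n. The terms are nonnegative
and the sum by rows converges, so the order may be exchanged. -/
lemma seriesValue_xiSeries (hy : 0 < y) {x : ℝ} (hx0 : 0 < x) (hx1 : x < 1) :
    seriesValue x (xiSeries y) = xiValue y x := by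
  classical
  set a : ℕ → ℕ := fun m => ⌊phiFun y ((m : ℝ) + 1)⌋₊ with ha
  set F : PowerSeries ℤ := PowerSeries.mk fun n =>
    (((Finset.range (n + 3)).filter fun m : ℕ => a m = n).card : ℤ) with hF
  have hsplit : xiSeries y = PowerSeries.C 1 + F := by
    ext n
    rw [xiSeries, map_add, PowerSeries.coeff_C, hF, PowerSeries.coeff_mk, PowerSeries.coeff_mk]
  have hFb : PolyBounded F := by
    have : F = xiSeries y + PowerSeries.C (-1) := by rw [hsplit]; simp
    rw [this]
    exact (xiSeries_polyBounded y).add (PolyBounded.C _)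
  rw [hsplit, (PolyBounded.C 1).seriesValue_add hFb hx0 hx1, seriesValue_C, xiValue]
  push_cast
  congr 1
  set u : ℕ × ℕ → ℝ := fun p => if a p.2 = p.1 then x ^ p.1 else 0 with hu
  have hu0 : 0 ≤ u := fun p => by
    simp only [hu, Pi.zero_apply]
    split_ifs <;> positivity
  have hout : ∀ n m : ℕ, m ∉ Finset.range (n + 3) → u (n, m) = 0 := fun n m hm => by
    simp only [hu]
    rw [if_neg]
    intro h
    exact hm (Finset.mem_range.2 (lt_add_three_of_floor_phiFun_eq hy h))
  have hrow : ∀ n : ℕ, ∑' m, u (n, m) = ((PowerSeries.coeff n F : ℤ) : ℝ) * x ^ n := fun n => by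
    rw [tsum_eq_sum (s := Finset.range (n + 3)) (fun m hm => hout n m hm), hF,
      PowerSeries.coeff_mk]
    simp only [hu]
    rw [← Finset.sum_filter, Finset.sum_const, nsmul_eq_mul]
    push_cast
    rfl
  have hsum : Summable u := by
    rw [summable_prod_of_nonneg hu0]
    refine ⟨fun n => summable_of_ne_finset_zero (s := Finset.range (n + 3)) (hout n), ?_⟩
    simp_rw [hrow]
    exact (hFb.summable_norm hx0 hx1).of_norm
  have hcomm := Summable.tsum_comm (f := fun n m => u (n, m)) hsum
  rw [seriesValue]
  simp_rw [← hrow]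
  rw [← hcomm]
  refine tsum_congr fun m => ?_
  simp only [hu]
  exact tsum_eq_single (a m) (fun n hn => if_neg (Ne.symm hn)) |>.trans (if_pos rfl)

lemma card_suppUpTo_xiSeries_le (hy : 0 < y) {M N : ℕ} (hM : 1 ≤ M)
    (h : (N : ℝ) + 1 ≤ phiFun y M) : (suppUpTo (xiSeries y) N).card ≤ M := by
  classical
  have hsub : suppUpTo (xiSeries y) N ⊆
      insert 0 ((Finset.Ico 1 M).image fun m : ℕ => ⌊phiFun y m⌋₊) := by
    intro n hn
    rw [mem_suppUpTo, coeff_xiSeries_ne_zero_iff hy] at hn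
    rw [Finset.mem_insert, Finset.mem_image]
    obtain ⟨hnN, h0 | ⟨m, hm, rfl⟩⟩ := hn
    · exact Or.inl h0
    · refine Or.inr ⟨m, ?_, rfl⟩
      rw [Finset.mem_Ico]
      refine ⟨hm, ?_⟩
      by_contra! hMm
      have h1 : phiFun y M ≤ phiFun y m :=
        phiFun_le_phiFun hy (by exact_mod_cast hM) (by exact_mod_cast hMm)
      have h2 := Nat.lt_floor_add_one (phiFun y (m : ℝ))
      have h3 : ((⌊phiFun y (m : ℝ)⌋₊ : ℕ) : ℝ) ≤ N := by exact_mod_cast hnN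
      linarith
  refine (Finset.card_le_card hsub).trans ((Finset.card_insert_le _ _).trans ?_)
  have := Finset.card_image_le (s := Finset.Ico 1 M) (f := fun m : ℕ => ⌊phiFun y m⌋₊)
  rw [Nat.card_Ico] at this
  omega

lemma exists_phiFun_le_lt (hy : 0 < y) {m₀ : ℕ} {x : ℝ} (h : phiFun y m₀ ≤ x) :
    ∃ m, m₀ ≤ m ∧ phiFun y m ≤ x ∧ x < phiFun y ((m : ℝ) + 1) := by
  classical
  have hex : ∃ n : ℕ, x < phiFun y ((m₀ + n : ℕ) : ℝ) := by
    obtain ⟨n, hn⟩ := exists_nat_gt x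
    refine ⟨n + 3, hn.trans_le ?_⟩
    refine le_trans ?_ (le_phiFun hy ?_)
    · push_cast
      linarith [(Nat.cast_nonneg m₀ : (0 : ℝ) ≤ m₀)]
    · push_cast
      linarith [(Nat.cast_nonneg m₀ : (0 : ℝ) ≤ m₀), (Nat.cast_nonneg n : (0 : ℝ) ≤ n)]
  have hs := Nat.find_spec hex
  have hpos : Nat.find hex ≠ 0 := by
    intro h0
    rw [h0, add_zero] at hs
    linarith
  obtain ⟨j, hj⟩ := Nat.exists_eq_succ_of_ne_zero hpos
  refine ⟨m₀ + j, by omega, ?_, ?_⟩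
  · exact not_lt.1 (Nat.find_min hex (m := j) (by omega))
  · rw [hj] at hs
    have : ((m₀ + j : ℕ) : ℝ) + 1 = ((m₀ + j.succ : ℕ) : ℝ) := by push_cast; ring
    rw [this]
    exact hs

/-- Relative gap between consecutive exponents. Bernoulli bounds the increment of (log)^(1+y) by its
derivative at the right end times 1/m, and e^s - 1 ≤ 2s for 0 ≤ s ≤ 1. -/
lemma phiFun_add_one_le (hy : 0 < y) {m : ℕ} (hm : 1 ≤ m) {η : ℝ} (hη1 : η ≤ 1)
    (hη : (1 + y) * Real.log ((m : ℝ) + 1) ^ y / m ≤ η) :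
    phiFun y ((m : ℝ) + 1) ≤ phiFun y m * (1 + 2 * η) := by
  have hm' : (1 : ℝ) ≤ m := by exact_mod_cast hm
  set u := Real.log m with hu
  set v := Real.log ((m : ℝ) + 1) with hv
  have hu0 : 0 ≤ u := Real.log_nonneg hm'
  have hv0 : 0 < v := Real.log_pos (by linarith)
  have huv : v - u ≤ 1 / m := by
    have h1 : v - u = Real.log (((m : ℝ) + 1) / m) := by
      rw [Real.log_div (by positivity) (by positivity)]
    rw [h1]
    refine (Real.log_le_sub_one_of_pos (by positivity)).trans (le_of_eq ?_)
    field_simp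
    ring
  have huv0 : u ≤ v := Real.log_le_log (by linarith) (by linarith)
  have hB : v ^ (1 + y) - u ^ (1 + y) ≤ (1 + y) * v ^ y * (v - u) := by
    have h1 := one_add_mul_self_le_rpow_one_add (s := (u - v) / v) (p := 1 + y)
      (by rw [le_div_iff₀ hv0]; linarith) (by linarith)
    have h2 : 1 + (u - v) / v = u / v := by field_simp; ring
    rw [h2, Real.div_rpow hu0 hv0.le, le_div_iff₀ (by positivity)] at h1
    have h3 : v ^ (1 + y) = v * v ^ y := by rw [Real.rpow_add hv0, Real.rpow_one]
    have h4 : (1 + (1 + y) * ((u - v) / v)) * v ^ (1 + y) =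
        v ^ (1 + y) + (1 + y) * v ^ y * (u - v) := by
      rw [h3]; field_simp
    rw [h4] at h1
    linarith
  have hd : v ^ (1 + y) - u ^ (1 + y) ≤ η := by
    refine hB.trans (le_trans ?_ hη)
    rw [div_eq_mul_one_div]
    gcongr
  have hd0 : 0 ≤ v ^ (1 + y) - u ^ (1 + y) :=
    sub_nonneg.2 (Real.rpow_le_rpow hu0 huv0 (by linarith))
  have hexp := Real.abs_exp_sub_one_le (x := v ^ (1 + y) - u ^ (1 + y))
    (by rw [abs_of_nonneg hd0]; linarith)
  rw [abs_of_nonneg hd0] at hexp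
  have hexp' := (abs_le.1 hexp).2
  have : phiFun y ((m : ℝ) + 1) = phiFun y m * Real.exp (v ^ (1 + y) - u ^ (1 + y)) := by
    rw [phiFun, phiFun, ← Real.exp_add]
    congr 1
    ring
  rw [this]
  exact mul_le_mul_of_nonneg_left (by linarith) (Real.exp_pos _).le

end PhiFun

/-! ### Asymptotic comparisons along powers of Q -/

section Asymptotics

open Filter

lemma eventually_const_le_log_rpow (c : ℝ) {r : ℝ} (hr : 0 < r) :
    ∀ᶠ Q : ℕ in atTop, c ≤ Real.log Q ^ r :=
  ((tendsto_rpow_atTop hr).comp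
    (Real.tendsto_log_atTop.comp tendsto_natCast_atTop_atTop)).eventually_ge_atTop c

lemma eventually_mul_log_rpow_le (c r : ℝ) :
    ∀ᶠ Q : ℕ in atTop, c * Real.log Q ^ r ≤ Q := by
  have h := (isLittleO_log_rpow_rpow_atTop r one_pos).comp_tendsto
    (tendsto_natCast_atTop_atTop (R := ℝ))
  filter_upwards [h.bound (c := 1 / (|c| + 1)) (by positivity), eventually_ge_atTop 1]
    with Q hQ hQ1
  have hQ1' : (1 : ℝ) ≤ Q := by exact_mod_cast hQ1
  have hp : 0 ≤ Real.log Q ^ r := Real.rpow_nonneg (Real.log_nonneg hQ1') _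
  simp only [Function.comp_apply, Real.rpow_one, Real.norm_eq_abs, abs_of_nonneg hp,
    abs_of_nonneg (by linarith : (0 : ℝ) ≤ Q)] at hQ
  rw [div_mul_eq_mul_div, one_mul, le_div_iff₀ (by positivity)] at hQ
  nlinarith [le_abs_self c]

variable {y : ℝ}

lemma phiFun_natCast_pow (y : ℝ) {Q : ℕ} (hQ : 1 ≤ Q) (k : ℕ) :
    phiFun y ((Q : ℝ) ^ k) = Real.exp ((k : ℝ) ^ (1 + y) * Real.log Q ^ (1 + y)) := by
  have hQ1' : (1 : ℝ) ≤ Q := by exact_mod_cast hQ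
  rw [phiFun, Real.log_pow, Real.mul_rpow (Nat.cast_nonneg _) (Real.log_nonneg hQ1')]

/-- The logarithms of the two φ-values differ by a positive multiple of (log Q)^(1+y), which beats
e·log Q because y > 0. -/
lemma eventually_pow_mul_phiFun_pow_le (hy : 0 < y) {j k : ℕ} (hjk : j < k) (e : ℕ) :
    ∀ᶠ Q : ℕ in atTop, (Q : ℝ) ^ e * phiFun y ((Q : ℝ) ^ j) ≤ phiFun y ((Q : ℝ) ^ k) := by
  have hc : 0 < (k : ℝ) ^ (1 + y) - (j : ℝ) ^ (1 + y) :=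
    sub_pos.2 (Real.rpow_lt_rpow (Nat.cast_nonneg _) (by exact_mod_cast hjk) (by linarith))
  filter_upwards [eventually_const_le_log_rpow (e / ((k : ℝ) ^ (1 + y) - (j : ℝ) ^ (1 + y))) hy,
    eventually_ge_atTop 2] with Q hQ hQ2
  have hQ2' : (2 : ℝ) ≤ Q := by exact_mod_cast hQ2
  have hu : 0 < Real.log Q := Real.log_pos (by linarith)
  rw [phiFun_natCast_pow y (by omega), phiFun_natCast_pow y (by omega)]
  have h1 : (Q : ℝ) ^ e = Real.exp (e * Real.log Q) := by
    rw [Real.exp_nat_mul, Real.exp_log (by linarith)]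
  rw [h1, ← Real.exp_add, Real.exp_le_exp]
  rw [div_le_iff₀ hc] at hQ
  have h3 : Real.log Q ^ (1 + y) = Real.log Q * Real.log Q ^ y := by
    rw [Real.rpow_add hu, Real.rpow_one]
  rw [h3]
  nlinarith [mul_le_mul_of_nonneg_left hQ hu.le]

/-- A power of log Q is negligible against Q. This is what makes a window of length Q long enough
for the gap obstruction. -/
lemma eventually_mul_phiFun_pow_lt (y : ℝ) (k e : ℕ) (C : ℝ) {β : ℝ} (hβ : 1 < β) :
    ∀ᶠ Q : ℕ in atTop, C * phiFun y ((Q : ℝ) ^ k) ^ e < β ^ Q := by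
  have hb : 0 < Real.log β := Real.log_pos hβ
  filter_upwards [eventually_mul_log_rpow_le (2 / Real.log β * (e * (k : ℝ) ^ (1 + y))) (1 + y),
    eventually_ge_atTop 1,
    (tendsto_natCast_atTop_atTop (R := ℝ)).eventually_gt_atTop
      (2 / Real.log β * Real.log (|C| + 1))] with Q hQ hQ1 hQ2
  rw [phiFun_natCast_pow y hQ1, ← Real.exp_nat_mul]
  have h1 : β ^ Q = Real.exp (Q * Real.log β) := by
    rw [Real.exp_nat_mul, Real.exp_log (by linarith)]
  have hC : C ≤ Real.exp (Real.log (|C| + 1)) := by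
    rw [Real.exp_log (by positivity)]
    linarith [le_abs_self C]
  rw [h1]
  refine (mul_le_mul_of_nonneg_right hC (Real.exp_pos _).le).trans_lt ?_
  rw [← Real.exp_add, Real.exp_lt_exp]
  rw [div_mul_eq_mul_div, div_lt_iff₀ hb] at hQ2
  have h4 : 2 / Real.log β * (e * (k : ℝ) ^ (1 + y)) * Real.log Q ^ (1 + y) =
      2 * (e * ((k : ℝ) ^ (1 + y) * Real.log Q ^ (1 + y))) / Real.log β := by ring
  rw [h4, div_le_iff₀ hb] at hQ
  linarith

/-- The separation of the two series: (log Q)^(y₂ - y₁) outgrows the constant k^(1+y₁). -/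
lemma eventually_phiFun_pow_le_phiFun {y₁ y₂ : ℝ} (h : y₁ < y₂) (k : ℕ) :
    ∀ᶠ Q : ℕ in atTop, phiFun y₁ ((Q : ℝ) ^ k) ≤ phiFun y₂ Q := by
  filter_upwards [eventually_const_le_log_rpow ((k : ℝ) ^ (1 + y₁)) (sub_pos.2 h),
    eventually_ge_atTop 2] with Q hQ hQ2
  have hQ2' : (2 : ℝ) ≤ Q := by exact_mod_cast hQ2
  have hu : 0 < Real.log Q := Real.log_pos (by linarith)
  rw [phiFun_natCast_pow y₁ (by omega), phiFun, Real.exp_le_exp]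
  have h3 : Real.log Q ^ (1 + y₂) = Real.log Q ^ (y₂ - y₁) * Real.log Q ^ (1 + y₁) := by
    rw [← Real.rpow_add hu]; congr 1; ring
  rw [h3]
  gcongr

/-- Consecutive values of φ eventually have ratio at most 3/2, so none can jump over [K, 2K]. -/
lemma eventually_exists_coeff_between (hy : 0 < y) :
    ∀ᶠ K : ℕ in atTop, ∃ s, PowerSeries.coeff s (xiSeries y) ≠ 0 ∧ K ≤ s ∧ s ≤ 2 * K := by
  have hev : ∀ᶠ m : ℕ in atTop, (1 + y) * Real.log ((m : ℝ) + 1) ^ y / m ≤ 1 / 4 := by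
    have h := (tendsto_add_atTop_nat 1).eventually
      (eventually_mul_log_rpow_le (8 * (1 + y)) y)
    filter_upwards [h, eventually_ge_atTop 1] with m hm hm1
    have hm1' : (1 : ℝ) ≤ m := by exact_mod_cast hm1
    push_cast at hm
    rw [div_le_iff₀ (by linarith)]
    linarith
  obtain ⟨m₀, hm₀⟩ := eventually_atTop.1 (hev.and (eventually_ge_atTop 1))
  filter_upwards [eventually_ge_atTop 3,
    (tendsto_natCast_atTop_atTop (R := ℝ)).eventually_ge_atTop (phiFun y m₀)] with K hK hK2
  have hK' : (3 : ℝ) ≤ K := by exact_mod_cast hK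
  obtain ⟨m, hm, h1, h2⟩ := exists_phiFun_le_lt hy (x := 2 * (K : ℝ)) (m₀ := m₀) (by linarith)
  obtain ⟨h3, h4⟩ := hm₀ m hm
  have h5 := phiFun_add_one_le hy h4 (by norm_num) h3
  refine ⟨⌊phiFun y m⌋₊, (coeff_xiSeries_ne_zero_iff hy).2 (Or.inr ⟨m, h4, rfl⟩), ?_, ?_⟩
  · refine Nat.le_floor ?_
    linarith
  · exact Nat.floor_le_of_le (by push_cast; exact h1)

/-- The range of x places the exponent just below it at an index m ≥ Q^(k-1), where the relative gap
is about (log m)^y / m. One further factor Q pays for the logarithm, which leaves Q^(k-2). -/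
lemma eventually_greedy_step (hy : 0 < y) {k : ℕ} (hk : 2 ≤ k) (e : ℕ) :
    ∀ᶠ Q : ℕ in atTop, ∀ x : ℝ, phiFun y ((Q : ℝ) ^ k) ≤ (Q : ℝ) ^ e * x →
      x < phiFun y ((Q : ℝ) ^ k) →
      ∃ s : ℕ, PowerSeries.coeff s (xiSeries y) ≠ 0 ∧ (s : ℝ) ≤ x ∧
        (x - s) * (Q : ℝ) ^ (k - 2) ≤ x := by
  obtain ⟨j, rfl⟩ := Nat.exists_eq_add_of_le' hk
  filter_upwards [eventually_pow_mul_phiFun_pow_le hy (show j + 1 < j + 2 by omega) e,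
    eventually_mul_log_rpow_le (4 * (1 + y) * ((j + 2 : ℕ) : ℝ) ^ y) y, eventually_ge_atTop 3]
    with Q hQ hQlog hQ3 x hx hx2
  have hQ3' : (3 : ℝ) ≤ Q := by exact_mod_cast hQ3
  have hQj : (1 : ℝ) ≤ (Q : ℝ) ^ j := one_le_pow₀ (by linarith)
  have hxφ : phiFun y ((Q : ℝ) ^ (j + 1)) ≤ x :=
    le_of_mul_le_mul_left (hQ.trans hx) (by positivity)
  obtain ⟨m, hm, h1, h2⟩ := exists_phiFun_le_lt hy (x := x) (m₀ := Q ^ (j + 1))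
    (by push_cast; exact hxφ)
  have hm' : (Q : ℝ) ^ (j + 1) ≤ m := by exact_mod_cast hm
  have hQj1 : (3 : ℝ) ≤ (Q : ℝ) ^ (j + 1) := by rw [pow_succ]; nlinarith
  have hm1 : (1 : ℝ) ≤ m := by linarith
  have hmlt : m + 1 ≤ Q ^ (j + 2) := by
    by_contra! hcon
    have h3 : (Q : ℝ) ^ (j + 2) ≤ m := by exact_mod_cast Nat.lt_succ_iff.1 hcon
    have := phiFun_le_phiFun hy (a := (Q : ℝ) ^ (j + 2)) (one_le_pow₀ (by linarith)) h3
    linarith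
  have hlog : Real.log ((m : ℝ) + 1) ≤ ((j + 2 : ℕ) : ℝ) * Real.log Q := by
    rw [← Real.log_pow]
    exact Real.log_le_log (by linarith) (by exact_mod_cast hmlt)
  have hlogy : (1 + y) * Real.log ((m : ℝ) + 1) ^ y ≤ Q / 4 := by
    have h3 : Real.log ((m : ℝ) + 1) ^ y ≤ ((j + 2 : ℕ) : ℝ) ^ y * Real.log Q ^ y := by
      rw [← Real.mul_rpow (Nat.cast_nonneg _) (Real.log_nonneg (by linarith))]
      exact Real.rpow_le_rpow (Real.log_nonneg (by linarith)) hlog hy.le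
    nlinarith [mul_le_mul_of_nonneg_left h3 (by linarith : 0 ≤ 1 + y)]
  have hη : (1 + y) * Real.log ((m : ℝ) + 1) ^ y / m ≤ 1 / (4 * (Q : ℝ) ^ j) := by
    calc (1 + y) * Real.log ((m : ℝ) + 1) ^ y / m ≤ (Q / 4) / (Q : ℝ) ^ (j + 1) := by
          gcongr
      _ = 1 / (4 * (Q : ℝ) ^ j) := by rw [pow_succ]; field_simp
  have hη1 : 1 / (4 * (Q : ℝ) ^ j) ≤ 1 := by
    rw [div_le_one (by positivity)]; linarith
  have h5 := phiFun_add_one_le hy (by exact_mod_cast hm1) hη1 hη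
  -- Absorbs the error of at most 1 made by the floor.
  have hx2Q : 2 * (Q : ℝ) ^ j ≤ x := by
    refine le_trans ?_ ((le_phiFun hy hQj1).trans hxφ)
    rw [pow_succ]; nlinarith
  refine ⟨⌊phiFun y m⌋₊, (coeff_xiSeries_ne_zero_iff hy).2
    (Or.inr ⟨m, by exact_mod_cast hm1, rfl⟩), (Nat.floor_le (Real.exp_pos _).le).trans h1, ?_⟩
  have h6 := Nat.lt_floor_add_one (phiFun y (m : ℝ))
  have h7 : phiFun y m * (1 + 2 * (1 / (4 * (Q : ℝ) ^ j))) =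
      phiFun y m + phiFun y m / (2 * (Q : ℝ) ^ j) := by field_simp; ring
  rw [h7] at h5
  have h8 : x - ⌊phiFun y m⌋₊ ≤ x / (2 * (Q : ℝ) ^ j) + 1 := by
    have : phiFun y m / (2 * (Q : ℝ) ^ j) ≤ x / (2 * (Q : ℝ) ^ j) := by gcongr
    linarith
  rw [Nat.add_sub_cancel]
  calc (x - ⌊phiFun y m⌋₊) * (Q : ℝ) ^ j ≤ (x / (2 * (Q : ℝ) ^ j) + 1) * (Q : ℝ) ^ j := by gcongr
    _ = x / 2 + (Q : ℝ) ^ j := by field_simp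
    _ ≤ x := by linarith

end Asymptotics

/-! ### Locating an isolated exponent of the leading monomial -/

section Location

open PowerSeries

/-- Iterating the greedy step: sums of `j` exponents approximate any `x` below the top of the
range. -/
lemma exists_coeff_pow_near {F : PowerSeries ℤ} (hF : CoeffNonneg F) (hF0 : coeff 0 F ≠ 0)
    {Q k e : ℕ} {T : ℝ} (hQ : 1 ≤ Q)
    (hstep : ∀ x : ℝ, T ≤ (Q : ℝ) ^ e * x → x < T →
      ∃ s : ℕ, coeff s F ≠ 0 ∧ (s : ℝ) ≤ x ∧ (x - s) * (Q : ℝ) ^ k ≤ x)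
    {x : ℝ} (hx0 : 0 ≤ x) (hxT : x < T) (j : ℕ) (hj : k * j ≤ e) :
    ∃ s : ℕ, coeff s (F ^ j) ≠ 0 ∧ (s : ℝ) ≤ x ∧ (x - s) * (Q : ℝ) ^ (k * j) ≤ T := by
  have hQ' : (1 : ℝ) ≤ Q := by exact_mod_cast hQ
  induction j with
  | zero => exact ⟨0, by simp, by simpa using hx0, by simpa using hxT.le⟩
  | succ j ih =>
    have hkj : k * (j + 1) = k * j + k := by ring
    obtain ⟨s, hs, hsx, hsT⟩ := ih (by omega)
    rcases lt_or_ge ((Q : ℝ) ^ e * (x - s)) T with h | h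
    -- The remainder is already below T / Q^e, outside the range of the greedy step; the exponent 0
    -- fills the slot.
    · refine ⟨s + 0, ?_, by simpa using hsx, ?_⟩
      · rw [pow_succ]
        exact (hF.pow j).coeff_add_mul_ne_zero hF hs hF0
      · have h2 : (Q : ℝ) ^ (k * (j + 1)) ≤ (Q : ℝ) ^ e := pow_le_pow_right₀ hQ' hj
        rw [Nat.add_zero]
        nlinarith [mul_le_mul_of_nonneg_left h2 (sub_nonneg.2 hsx)]
    · have hs0 : (0 : ℝ) ≤ s := Nat.cast_nonneg _
      obtain ⟨s', hs', hsx', hsT'⟩ := hstep (x - s) h (by linarith)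
      refine ⟨s + s', ?_, by push_cast; linarith, ?_⟩
      · rw [pow_succ]
        exact (hF.pow j).coeff_add_mul_ne_zero hF hs hs'
      · calc (x - ((s + s' : ℕ) : ℝ)) * (Q : ℝ) ^ (k * (j + 1))
            = ((x - s - s') * (Q : ℝ) ^ k) * (Q : ℝ) ^ (k * j) := by
              rw [hkj, pow_add]; push_cast; ring
          _ ≤ (x - s) * (Q : ℝ) ^ (k * j) := by gcongr
          _ ≤ T := hsT

lemma card_suppUpTo_pow_mul_pow_le {F₁ F₂ : PowerSeries ℤ} {N Q k : ℕ}
    (h₁ : (suppUpTo F₁ N).card ≤ Q ^ k) (h₂ : (suppUpTo F₂ N).card ≤ Q) (a b : ℕ) :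
    (suppUpTo (F₁ ^ a * F₂ ^ b) N).card ≤ Q ^ (k * a + b) := by
  refine (card_suppUpTo_mul_le _ _ _).trans ?_
  rw [pow_add, pow_mul]
  exact Nat.mul_le_mul ((card_suppUpTo_pow_le _ _ _).trans (Nat.pow_le_pow_left h₁ _))
    ((card_suppUpTo_pow_le _ _ _).trans (Nat.pow_le_pow_left h₂ _))

/-- Elements of the support of the leading monomial that are far from all lower monomials,
together with a window avoiding all monomials. -/
lemma exists_isolated_exponent {F₁ F₂ : PowerSeries ℤ} (hF₁ : CoeffNonneg F₁)
    (hF₂ : CoeffNonneg F₂) (h₁0 : coeff 0 F₁ ≠ 0) (h₂0 : coeff 0 F₂ ≠ 0) {a b D N l K W : ℕ}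
    (hgap : ∀ x : ℕ, x ≤ N → ∃ s, coeff s (F₁ ^ (a + 1)) ≠ 0 ∧ s ≤ x ∧ x ≤ s + l)
    (hK : ∃ s, coeff s F₂ ≠ 0 ∧ K ≤ s ∧ s ≤ 2 * K)
    (hN : 4 * l * ((suppUpTo (F₁ ^ a * F₂ ^ D) N).card + 1) ≤ N)
    (hl : 3 * K * ((suppUpTo (F₁ ^ (a + 1) * F₂ ^ b) N).card + 1) + 1 ≤ l)
    (hW : W * ((suppUpTo (F₁ ^ (a + 1) * F₂ ^ D) N).card + 1) + 1 ≤ K) :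
    ∃ R t q, R < t ∧ R + W + 1 ≤ N ∧ q ≤ N ∧ t + W ≤ q ∧ t < q ∧
      (∀ n, R < n → n ≤ R + W → coeff n (F₁ ^ (a + 1) * F₂ ^ D) = 0) ∧
      (∀ n, R < n → n < q →
        coeff n (F₁ ^ (a + 1) * F₂ ^ b) = 0 ∧ coeff n (F₁ ^ a * F₂ ^ D) = 0) ∧
      coeff t (F₁ ^ (a + 1) * F₂ ^ (b + 1)) ≠ 0 := by
  obtain ⟨b₀, -, hb₀, hU₂⟩ := exists_block_avoiding (suppUpTo (F₁ ^ a * F₂ ^ D) N)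
    (Nat.lt_succ_self _) (l := 4 * l) 0
  have hb₀N : b₀ + 4 * l ≤ N := by
    refine hb₀.trans ?_
    rw [zero_add]
    exact hN
  -- Aiming at the middle of the block keeps p₁ at least l above its start and leaves 2l of room to
  -- the right.
  obtain ⟨p₁, hp₁, hp₁le, hp₁ge⟩ := hgap (b₀ + 2 * l) (by omega)
  obtain ⟨b₁, hpb₁, hb₁, hU₁⟩ := exists_block_avoiding (suppUpTo (F₁ ^ (a + 1) * F₂ ^ b) N)
    (Nat.lt_succ_self _) (l := 3 * K) (p₁ + 1)
  have hb₁l : b₁ + 3 * K ≤ b₀ + 4 * l := by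
    refine hb₁.trans ?_
    rw [Nat.succ_eq_add_one]
    omega
  have hp₁U : coeff p₁ (F₁ ^ (a + 1) * F₂ ^ b) ≠ 0 := by
    refine hF₁.coeff_pow_mul_pow_ne_zero hF₂ h₁0 h₂0 le_rfl (Nat.zero_le b) ?_
    rwa [pow_zero, mul_one]
  -- Its maximum p is the last exponent of F₁^(a+1) F₂^b before the free block of length 3K, so
  -- nothing of that product lies strictly between p and p + 3K.
  set S := (suppUpTo (F₁ ^ (a + 1) * F₂ ^ b) N).filter (· < b₁) with hS
  have hSne : S.Nonempty :=
    ⟨p₁, Finset.mem_filter.2 ⟨mem_suppUpTo.2 ⟨by omega, hp₁U⟩, by omega⟩⟩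
  set p := S.max' hSne with hp
  have hpS : p ∈ S := S.max'_mem hSne
  have hp₁p : p₁ ≤ p :=
    S.le_max' _ (Finset.mem_filter.2 ⟨mem_suppUpTo.2 ⟨by omega, hp₁U⟩, by omega⟩)
  obtain ⟨hpU, hpb⟩ := Finset.mem_filter.1 hpS
  have hpU' := (mem_suppUpTo.1 hpU).2
  obtain ⟨s, hs, hKs, hs2K⟩ := hK
  obtain ⟨b₂, hpb₂, hb₂, hV⟩ := exists_block_avoiding (suppUpTo (F₁ ^ (a + 1) * F₂ ^ D) N)
    (Nat.lt_succ_self _) (l := W) (p + 1)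
  have hb₂K : b₂ + W ≤ p + K := by
    refine hb₂.trans ?_
    rw [Nat.succ_eq_add_one]
    omega
  have hWK : W < K := by nlinarith
  -- The empty window lies in (p, p + K), while t = p + s lies in [p + K, p + 2K]; since W < K, this
  -- leaves t + W ≤ p + 3K.
  refine ⟨b₂ - 1, p + s, p + 3 * K, by omega, by omega, by omega, by omega, by omega, ?_, ?_, ?_⟩
  · intro n hn1 hn2
    by_contra hne
    exact hV n (mem_suppUpTo.2 ⟨by omega, hne⟩) (by omega) (by omega)
  · intro n hn1 hn2
    constructor
    · by_contra hne
      have hmem : n ∈ suppUpTo (F₁ ^ (a + 1) * F₂ ^ b) N := mem_suppUpTo.2 ⟨by omega, hne⟩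
      rcases lt_or_ge n b₁ with h | h
      · have := S.le_max' n (Finset.mem_filter.2 ⟨hmem, h⟩)
        omega
      · exact hU₁ n hmem h (by omega)
    · by_contra hne
      exact hU₂ n (mem_suppUpTo.2 ⟨by omega, hne⟩) (by omega) (by omega)
  · rw [pow_succ F₂, ← mul_assoc]
    exact ((hF₁.pow _).mul (hF₂.pow _)).coeff_add_mul_ne_zero hF₂ hpU' hs

end Location

/-! ### Choice of parameters and the contradiction -/

/-- A polynomial relation between `ξ(y₁; β⁻¹)` and `ξ(y₂; β⁻¹)` whose leading monomial
in the lexicographic order involves both variables is impossible. -/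
lemma false_of_relation {y₁ y₂ : ℝ} (hy₁ : 0 < y₁) (hy : y₁ < y₂) {β : ℝ} (hβ1 : 1 < β)
    (hint : IsIntegral ℤ β)
    (hconj : ∀ z : ℂ, IsConjRoot ℚ (β : ℂ) z → z ≠ (β : ℂ) → ‖z‖ ≤ 1)
    (Λ : Finset (ℕ × ℕ)) (c : ℕ × ℕ → ℤ) {a b : ℕ} (hmem : (a + 1, b + 1) ∈ Λ)
    (hc : 0 < c (a + 1, b + 1))
    (hlex : ∀ d ∈ Λ, d ≠ (a + 1, b + 1) → d.1 ≤ a ∨ (d.1 = a + 1 ∧ d.2 ≤ b))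
    (hrel : ∑ d ∈ Λ, (c d : ℝ) * (xiValue y₁ β⁻¹ ^ d.1 * xiValue y₂ β⁻¹ ^ d.2) = 0) : False := by
  classical
  have hy₂ : 0 < y₂ := hy₁.trans hy
  have hx0 : 0 < β⁻¹ := by positivity
  have hx1 : β⁻¹ < 1 := inv_lt_one_of_one_lt₀ hβ1
  set F₁ := xiSeries y₁ with hF₁def
  set F₂ := xiSeries y₂ with hF₂def
  have hF₁ : CoeffNonneg F₁ := xiSeries_coeffNonneg y₁
  have hF₂ : CoeffNonneg F₂ := xiSeries_coeffNonneg y₂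
  have h₁0 : PowerSeries.coeff 0 F₁ ≠ 0 := (coeff_xiSeries_ne_zero_iff hy₁).2 (Or.inl rfl)
  have h₂0 : PowerSeries.coeff 0 F₂ ≠ 0 := (coeff_xiSeries_ne_zero_iff hy₂).2 (Or.inl rfl)
  have hb₁ : PolyBounded F₁ := xiSeries_polyBounded y₁
  have hb₂ : PolyBounded F₂ := xiSeries_polyBounded y₂
  set G : PowerSeries ℤ := ∑ d ∈ Λ, PowerSeries.C (c d) * (F₁ ^ d.1 * F₂ ^ d.2) with hG
  have hterm : ∀ d ∈ Λ, PolyBounded (PowerSeries.C (c d) * (F₁ ^ d.1 * F₂ ^ d.2)) := fun d _ =>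
    (PolyBounded.C _).mul ((hb₁.pow _).mul (hb₂.pow _))
  have hGb : PolyBounded G := PolyBounded.sum Λ hterm
  have hG0 : seriesValue β⁻¹ G = 0 := by
    rw [hG, PolyBounded.seriesValue_sum Λ hterm hx0 hx1, ← hrel]
    refine Finset.sum_congr rfl fun d _ => ?_
    rw [(PolyBounded.C _).seriesValue_mul ((hb₁.pow _).mul (hb₂.pow _)) hx0 hx1, seriesValue_C,
      (hb₁.pow _).seriesValue_mul (hb₂.pow _) hx0 hx1, hb₁.seriesValue_pow hx0 hx1,
      hb₂.seriesValue_pow hx0 hx1, seriesValue_xiSeries hy₁ hx0 hx1,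
      seriesValue_xiSeries hy₂ hx0 hx1]
  have hGcoeff : ∀ n, PowerSeries.coeff n G =
      ∑ d ∈ Λ, c d * PowerSeries.coeff n (F₁ ^ d.1 * F₂ ^ d.2) := fun n => by
    rw [hG, map_sum]
    exact Finset.sum_congr rfl fun d _ => PowerSeries.coeff_C_mul _ _ _
  set D := Λ.sup Prod.snd with hD
  have hle : ∀ d ∈ Λ, d.2 ≤ D := fun d hd => Finset.le_sup (f := Prod.snd) hd
  have hbD : b + 1 ≤ D := hle _ hmem
  -- By monotonicity of supports, F₁^(a+1) F₂^D covers all monomials, and the non-leading ones are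
  -- covered by F₁^a F₂^D together with F₁^(a+1) F₂^b.
  have hzero : ∀ n, PowerSeries.coeff n (F₁ ^ (a + 1) * F₂ ^ D) = 0 →
      PowerSeries.coeff n G = 0 := by
    intro n hn
    rw [hGcoeff]
    refine Finset.sum_eq_zero fun d hd => ?_
    by_contra hne
    refine hF₁.coeff_pow_mul_pow_ne_zero hF₂ h₁0 h₂0 ?_ (hle d hd) (right_ne_zero_of_mul hne) hn
    by_cases h : d = (a + 1, b + 1)
    · rw [h]
    · rcases hlex d hd h with h | h <;> omega
  have hlead : ∀ n, PowerSeries.coeff n (F₁ ^ (a + 1) * F₂ ^ b) = 0 →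
      PowerSeries.coeff n (F₁ ^ a * F₂ ^ D) = 0 → PowerSeries.coeff n G =
        c (a + 1, b + 1) * PowerSeries.coeff n (F₁ ^ (a + 1) * F₂ ^ (b + 1)) := by
    intro n hn1 hn2
    rw [hGcoeff]
    refine Finset.sum_eq_single_of_mem _ hmem fun d hd hne => ?_
    by_contra hne'
    have hr := right_ne_zero_of_mul hne'
    rcases hlex d hd hne with h | ⟨h1, h2⟩
    · exact hF₁.coeff_pow_mul_pow_ne_zero hF₂ h₁0 h₂0 h (hle d hd) hr hn2
    · exact hF₁.coeff_pow_mul_pow_ne_zero hF₂ h₁0 h₂0 h1.le h2 hr hn1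
  obtain ⟨C, e, hobs⟩ := hGb.exists_gap_obstruction hβ1 hint hconj hG0
  -- parameters
  obtain ⟨k, hk⟩ : ∃ k, k = 2 * (a + 1) + D := ⟨_, rfl⟩
  -- Q^E will bound the number of exponents of F₁^(a+1) F₂^D. The nested scales are then W = Q, K =
  -- Q^(E+2) and l ≥ Q^(2E+4).
  obtain ⟨E, hE⟩ : ∃ E, E = (k + 2) * (a + 1) + D := ⟨_, rfl⟩
  have hKev : ∀ᶠ Q : ℕ in Filter.atTop, ∃ s, PowerSeries.coeff s F₂ ≠ 0 ∧
      Q ^ (E + 2) ≤ s ∧ s ≤ 2 * Q ^ (E + 2) :=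
    (Filter.tendsto_pow_atTop (by omega)).eventually (eventually_exists_coeff_between hy₂)
  obtain ⟨Q, hQ16, hQβ, hQF₂, hQK, hQstep, hQT⟩ :=
    ((Filter.eventually_ge_atTop 16).and
      ((eventually_mul_phiFun_pow_lt y₁ (k + 2) e (|C| * 2 ^ e) hβ1).and
      ((eventually_phiFun_pow_le_phiFun hy (k + 2)).and
      (hKev.and
      ((eventually_greedy_step hy₁ (show 2 ≤ k + 2 by omega) (k * (a + 1))).and
      (eventually_pow_mul_phiFun_pow_le hy₁ (show 0 < k + 2 by omega)
        (k * (a + 1) + (2 * E + 4)))))))).exists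
  rw [Nat.add_sub_cancel] at hQstep
  set T := phiFun y₁ ((Q : ℝ) ^ (k + 2)) with hT
  have hQ16' : (16 : ℝ) ≤ Q := by exact_mod_cast hQ16
  have hTQ : (Q : ℝ) ^ (k * (a + 1) + (2 * E + 4)) ≤ T := by
    refine le_trans (le_mul_of_one_le_right (by positivity) ?_) hQT
    exact one_le_phiFun (by simp)
  have hT16 : 16 ≤ T := by
    refine hQ16'.trans (le_trans ?_ hTQ)
    exact le_self_pow₀ (by linarith) (by omega)
  obtain ⟨N, hN⟩ : ∃ N, ⌊T⌋₊ = N + 1 :=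
    Nat.exists_eq_add_of_le' (Nat.le_floor (by push_cast; linarith))
  have hNT : (N : ℝ) + 1 ≤ T := by
    have := Nat.floor_le (by linarith : 0 ≤ T)
    rw [hN] at this
    exact_mod_cast this
  have hTN : T < (N : ℝ) + 2 := by
    have := Nat.lt_floor_add_one T
    rw [hN] at this
    push_cast at this
    linarith
  have hc₁ : (suppUpTo F₁ N).card ≤ Q ^ (k + 2) :=
    card_suppUpTo_xiSeries_le hy₁ (Nat.one_le_pow _ _ (by omega)) (by push_cast; exact hNT)
  have hc₂ : (suppUpTo F₂ N).card ≤ Q :=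
    card_suppUpTo_xiSeries_le hy₂ (by omega) (hNT.trans hQF₂)
  set P : ℝ := (Q : ℝ) ^ (k * (a + 1)) with hP
  have hP0 : 0 < P := by positivity
  set l := ⌈T / P⌉₊ with hl
  have hlP : T ≤ l * P := by
    rw [← div_le_iff₀ hP0]
    exact Nat.le_ceil _
  have hTP : (Q : ℝ) ^ (2 * E + 4) ≤ T / P := by
    rw [le_div_iff₀ hP0, hP, ← pow_add, add_comm]
    exact hTQ
  have hlge : Q ^ (2 * E + 4) ≤ l := by
    have := hTP.trans (Nat.le_ceil (T / P))
    exact_mod_cast this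
  have hlle : (l : ℝ) * P ≤ 2 * T := by
    have h1 : (l : ℝ) < T / P + 1 := Nat.ceil_lt_add_one (by positivity)
    have h2 : (1 : ℝ) ≤ T / P := (one_le_pow₀ (by linarith)).trans hTP
    have h3 : (l : ℝ) ≤ 2 * (T / P) := by linarith
    calc (l : ℝ) * P ≤ 2 * (T / P) * P := by gcongr
      _ = 2 * T := by field_simp
  have hgap : ∀ x : ℕ, x ≤ N →
      ∃ s, PowerSeries.coeff s (F₁ ^ (a + 1)) ≠ 0 ∧ s ≤ x ∧ x ≤ s + l := by
    intro x hx
    have hx' : (x : ℝ) ≤ N := by exact_mod_cast hx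
    obtain ⟨s, hs, hsx, hsT⟩ := exists_coeff_pow_near hF₁ h₁0 (show 1 ≤ Q by omega) hQstep
      (Nat.cast_nonneg x) (by linarith) (a + 1) le_rfl
    refine ⟨s, hs, by exact_mod_cast hsx, ?_⟩
    have : (x : ℝ) - s ≤ l := le_of_mul_le_mul_right (hsT.trans hlP) hP0
    have : (x : ℝ) ≤ ((s + l : ℕ) : ℝ) := by push_cast; linarith
    exact_mod_cast this
  have hcard := card_suppUpTo_pow_mul_pow_le hc₁ hc₂
  have hXpos : 1 ≤ Q ^ E := Nat.one_le_pow _ _ (by omega)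
  have hNineq : 4 * l * ((suppUpTo (F₁ ^ a * F₂ ^ D) N).card + 1) ≤ N := by
    have h1 := hcard a D
    set Y := Q ^ ((k + 2) * a + D) with hY
    have hY1 : 1 ≤ Y := Nat.one_le_pow _ _ (by omega)
    -- The reason for the value of k: k(a+1) = (k+2)a + D + 2, so the greedy density beats the count
    -- of lower exponents by Q².
    have hPY : P = (Y : ℝ) * Q ^ 2 := by
      rw [hP, hY]
      push_cast
      rw [← pow_add]
      congr 1
      rw [hk]; ring
    refine (Nat.mul_le_mul_left _ (Nat.add_le_add_right h1 1)).trans ?_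
    have hY1' : (1 : ℝ) ≤ Y := by exact_mod_cast hY1
    have h2 : (l : ℝ) * Y * 256 ≤ 2 * T := by
      refine le_trans ?_ hlle
      rw [hPY, ← mul_assoc]
      gcongr
      nlinarith
    have h3 : 4 * (l : ℝ) * (Y + 1) ≤ N := by
      have : 4 * (l : ℝ) * (Y + 1) ≤ 8 * (l * Y) := by
        have hl0 : (0 : ℝ) ≤ l := Nat.cast_nonneg _
        nlinarith
      linarith
    exact_mod_cast h3
  have hlineq : 3 * Q ^ (E + 2) * ((suppUpTo (F₁ ^ (a + 1) * F₂ ^ b) N).card + 1) + 1 ≤ l := by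
    have h1 : (suppUpTo (F₁ ^ (a + 1) * F₂ ^ b) N).card ≤ Q ^ E :=
      (hcard _ _).trans (Nat.pow_le_pow_right (by omega) (by omega))
    refine le_trans ?_ hlge
    calc 3 * Q ^ (E + 2) * ((suppUpTo (F₁ ^ (a + 1) * F₂ ^ b) N).card + 1) + 1
        ≤ 3 * Q ^ (E + 2) * (Q ^ E + Q ^ E) + Q ^ (E + 2) * Q ^ E := by
          gcongr
          exact Nat.one_le_iff_ne_zero.2 (by positivity)
      _ = 7 * (Q ^ (E + 2) * Q ^ E) := by ring
      _ ≤ Q ^ 2 * (Q ^ (E + 2) * Q ^ E) := by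
          gcongr
          nlinarith
      _ = Q ^ (2 * E + 4) := by ring
  have hWineq : Q * ((suppUpTo (F₁ ^ (a + 1) * F₂ ^ D) N).card + 1) + 1 ≤ Q ^ (E + 2) := by
    have h1 : (suppUpTo (F₁ ^ (a + 1) * F₂ ^ D) N).card ≤ Q ^ E :=
      (hcard _ _).trans (Nat.pow_le_pow_right (by omega) (by omega))
    calc Q * ((suppUpTo (F₁ ^ (a + 1) * F₂ ^ D) N).card + 1) + 1
        ≤ Q * (Q ^ E + Q ^ E) + Q * Q ^ E := by
          gcongr
          exact Nat.one_le_iff_ne_zero.2 (by positivity)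
      _ = 3 * (Q * Q ^ E) := by ring
      _ ≤ Q * (Q * Q ^ E) := by
          gcongr
          omega
      _ = Q ^ (E + 2) := by ring
  obtain ⟨R, t, q, hRt, hRN, hqN, htq, htq', hwin, hfree, ht⟩ := exists_isolated_exponent hF₁ hF₂
    h₁0 h₂0 hgap hQK hNineq hlineq hWineq
  refine hobs N R t q Q hRt hRN hqN htq ?_ (fun n hn1 hn2 => hzero n (hwin n hn1 hn2))
    (fun n hn1 hn2 => ?_) ?_
  -- The factor 2^e comes from N + 2 ≤ 2T.
  · refine lt_of_le_of_lt ?_ hQβ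
    rw [mul_assoc, ← mul_pow]
    gcongr
    · exact le_abs_self C
    · linarith
  · rw [hlead n (hfree n hn1 hn2).1 (hfree n hn1 hn2).2]
    exact mul_nonneg hc.le ((hF₁.pow _).mul (hF₂.pow _) n)
  · rw [hlead t (hfree t hRt htq').1 (hfree t hRt htq').2]
    exact mul_ne_zero hc.ne' ht

/-! ### From integral relations to algebraic independence -/

/-- Nonvanishing of integral polynomial expressions in `ξ(y₁; β⁻¹)` and `ξ(y₂; β⁻¹)`. -/
lemma relation_trivial {y₁ y₂ : ℝ} (hy₁ : 0 < y₁) (hy : y₁ < y₂) {β : ℝ} (hβ1 : 1 < β)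
    (hint : IsIntegral ℤ β)
    (hconj : ∀ z : ℂ, IsConjRoot ℚ (β : ℂ) z → z ≠ (β : ℂ) → ‖z‖ ≤ 1)
    (Λ : Finset (ℕ × ℕ)) (c : ℕ × ℕ → ℤ) (hc : ∀ d ∈ Λ, c d ≠ 0)
    (hrel : ∑ d ∈ Λ, (c d : ℝ) * (xiValue y₁ β⁻¹ ^ d.1 * xiValue y₂ β⁻¹ ^ d.2) = 0) : Λ = ∅ := by
  classical
  by_contra hΛ
  obtain ⟨m, hm, hmax⟩ := Finset.exists_max_image Λ (fun d => toLex d)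
    (Finset.nonempty_iff_ne_empty.2 hΛ)
  have hinj : Function.Injective fun d : ℕ × ℕ => (d.1 + 1, d.2 + 1) := by
    rintro ⟨a, b⟩ ⟨a', b'⟩ h
    simpa using h
  -- Scaling by the leading coefficient makes it positive; shifting all exponents by one makes both
  -- leading exponents positive.
  obtain ⟨ε, hε⟩ : ∃ ε : ℤ, 0 < ε * c m := ⟨c m, mul_self_pos.2 (hc m hm)⟩
  refine false_of_relation hy₁ hy hβ1 hint hconj
    (Λ.image fun d => (d.1 + 1, d.2 + 1)) (fun d => ε * c (d.1 - 1, d.2 - 1)) (a := m.1) (b := m.2)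
    (Finset.mem_image_of_mem _ hm) (by simpa using hε) ?_ ?_
  · intro d hd hne
    obtain ⟨u, hu, rfl⟩ := Finset.mem_image.1 hd
    have hne' : u ≠ m := fun h => hne (by rw [h])
    have := lt_of_le_of_ne (hmax u hu) (fun h => hne' (toLex.injective h))
    rw [Prod.Lex.toLex_lt_toLex] at this
    dsimp only
    omega
  · rw [Finset.sum_image hinj.injOn]
    have : ∀ d ∈ Λ, ((ε * c (d.1 + 1 - 1, d.2 + 1 - 1) : ℤ) : ℝ) *
        (xiValue y₁ β⁻¹ ^ (d.1 + 1) * xiValue y₂ β⁻¹ ^ (d.2 + 1)) =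
        ε * xiValue y₁ β⁻¹ * xiValue y₂ β⁻¹ *
          ((c d : ℝ) * (xiValue y₁ β⁻¹ ^ d.1 * xiValue y₂ β⁻¹ ^ d.2)) := fun d _ => by
      simp only [Nat.add_sub_cancel]
      push_cast
      ring
    refine (Finset.sum_congr rfl this).trans ?_
    rw [← Finset.mul_sum, hrel, mul_zero]

/-- Clearing denominators turns a rational relation into an integral one with the same support. -/
lemma algebraicIndependent_pair_of_relation_trivial {u v : ℝ}
    (h : ∀ (Λ : Finset (ℕ × ℕ)) (c : ℕ × ℕ → ℤ), (∀ d ∈ Λ, c d ≠ 0) →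
      ∑ d ∈ Λ, (c d : ℝ) * (u ^ d.1 * v ^ d.2) = 0 → Λ = ∅) :
    AlgebraicIndependent ℚ ![u, v] := by
  classical
  rw [algebraicIndependent_iff]
  intro p hp
  obtain ⟨b, hb⟩ := IsLocalization.exist_integer_multiples (nonZeroDivisors ℤ) p.support
    (fun d => MvPolynomial.coeff d p)
  choose! c hc using hb
  have hb0 : ((b : ℤ) : ℚ) ≠ 0 := by exact_mod_cast nonZeroDivisors.ne_zero b.2
  have hc' : ∀ d ∈ p.support, ((c d : ℤ) : ℚ) = (b : ℤ) * MvPolynomial.coeff d p := fun d hd => by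
    simpa using hc d hd
  set g : ℕ × ℕ → (Fin 2 →₀ ℕ) := fun d => Finsupp.equivFunOnFinite.symm ![d.1, d.2] with hg
  have hgf : ∀ d : Fin 2 →₀ ℕ, g (d 0, d 1) = d := fun d => by
    ext i
    fin_cases i <;> simp [hg]
  have hinj : Function.Injective fun d : Fin 2 →₀ ℕ => (d 0, d 1) :=
    Function.LeftInverse.injective hgf
  have hΛ := h (p.support.image fun d => (d 0, d 1)) (fun d => c (g d)) ?_ ?_
  · rw [Finset.image_eq_empty, MvPolynomial.support_eq_empty] at hΛ
    exact hΛ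
  · intro d hd
    obtain ⟨s, hs, rfl⟩ := Finset.mem_image.1 hd
    rw [hgf]
    intro h0
    have := hc' s hs
    rw [h0, Int.cast_zero] at this
    exact mul_ne_zero hb0 (MvPolynomial.mem_support_iff.1 hs) this.symm
  · rw [Finset.sum_image hinj.injOn]
    rw [MvPolynomial.aeval_def, MvPolynomial.eval₂_eq'] at hp
    have : ∀ d ∈ p.support, (c (g (d 0, d 1)) : ℝ) * (u ^ d 0 * v ^ d 1) =
        (b : ℤ) * (algebraMap ℚ ℝ (MvPolynomial.coeff d p) * ∏ i, ![u, v] i ^ d i) := fun d hd => by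
      rw [hgf, Fin.prod_univ_two]
      have h1 : (c d : ℝ) = (b : ℤ) * algebraMap ℚ ℝ (MvPolynomial.coeff d p) := by
        have := congrArg (algebraMap ℚ ℝ) (hc' d hd)
        simpa using this
      rw [h1]
      simp only [Matrix.cons_val_zero, Matrix.cons_val_one]
      ring
    rw [Finset.sum_congr rfl this, ← Finset.mul_sum, hp, mul_zero]

theorem mainTheorem10 (y₁ y₂ : ℝ) (hy₁ : 0 < y₁) (hy₂ : 0 < y₂) (hne : y₁ ≠ y₂)
    (β : ℝ) (hβ : IsPisotNumber β ∨ IsSalemNumber β) :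
    AlgebraicIndependent ℚ ![xiValue y₁ β⁻¹, xiValue y₂ β⁻¹] := by
  classical
  obtain ⟨hint, hβ1, hconj⟩ : IsIntegral ℤ β ∧ 1 < β ∧
      ∀ z : ℂ, IsConjRoot ℚ (β : ℂ) z → z ≠ (β : ℂ) → ‖z‖ ≤ 1 := by
    rcases hβ with h | h
    · exact ⟨h.1, h.2.1, fun z hz hne => (h.2.2 z hz hne).le⟩
    · exact ⟨h.1, h.2.1, h.2.2.1⟩
  refine algebraicIndependent_pair_of_relation_trivial fun Λ c hc hrel => ?_
  rcases lt_or_gt_of_ne hne with h | h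
  · exact relation_trivial hy₁ h hβ1 hint hconj Λ c hc hrel
  · have := relation_trivial hy₂ h hβ1 hint hconj (Λ.image Prod.swap) (fun d => c d.swap)
      (fun d hd => ?_) ?_
    · exact Finset.image_eq_empty.1 this
    · obtain ⟨s, hs, rfl⟩ := Finset.mem_image.1 hd
      exact hc s hs
    · rw [Finset.sum_image Prod.swap_injective.injOn, ← hrel]
      refine Finset.sum_congr rfl fun d _ => ?_
      simp only [Prod.swap_swap, Prod.fst_swap, Prod.snd_swap]
      ring
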